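/- Let $k$ be an algebraically closed field and let $M$ be an affine algebraic monoid over $k$, i.e. an affine algebraic variety (not necessarily irreducible) with an associative multiplication $M\times M\to M$ that is a morphism of varieties and has a neutral element. Let $G$ be its unit group, an algebraic group that is open in $M$, let $H\subseteq G$ be a subgroup that is closed in $G$, and let $V$ be a finite-dimensional rational right $H$-module. Then there exist a finite-dimensional rational right $M$-module $W$, an extendible character $\chi : H\to \mathbb{G}_m$ and an injective morphism of right $H$-modules $$\iota : V\longrightarrow (W|_H)_{\chi^{-1}}.$$ Here a finite-dimensional right module $U$ over $N=H$ or $N=M$ is rational if for all $\alpha\in U^*$ and $u\in U$ the function $x\mapsto \alpha(u\cdot x)$ is regular on $N$. A character of $H$ is a homomorphism of algebraic groups $\chi: H\to\mathbb{G}_m$; it is extendible if there is a nonzero regular function $f\in k[M]$ with $f(xm)=\chi(x)f(m)$ for all $x\in H$ and $m\in M$ (the trivial character is thus extendible). For a right $H$-module $U$ and a character $\psi$ of $H$, the twist $U_\psi$ is the vector space $U$ with the action $u\star x=\psi(x)\,(u\cdot x)$. -/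

import Mathlib

universe u v w

/-- The structure of an affine algebraic variety over `k` (not necessarily irreducible) on a set
`X`: the algebra `k[X]` of regular functions is a finitely generated `k`-algebra of `k`-valued
functions on `X`, and the points of `X` are, through evaluation, exactly the `k`-algebra
homomorphisms `k[X] → k`.  (Used for `k` algebraically closed.) -/
class AffineVariety (k : Type u) (X : Type v) [Field k] where
  /-- the algebra `k[X]` of regular functions -/
  regular : Subalgebra k (X → k)
  regular_fg : regular.FG
  eval_bijective : Function.Bijective
    (fun x : X => ((Pi.evalAlgHom k (fun _ : X => k) x).comp regular.val : regular →ₐ[k] k))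

namespace AffineVariety

variable (k : Type u) [Field k]

/-- The set of common zeros of a set of functions. -/
def zeroLocus {X : Type v} (I : Set (X → k)) : Set X := {x | ∀ f ∈ I, f x = 0}

/-- The Zariski topology: the closed sets are the zero loci of sets of regular functions. -/
@[reducible] def zariski (X : Type v) [AffineVariety k X] : TopologicalSpace X :=
  TopologicalSpace.ofClosed
    {Z | ∃ I : Set (X → k), I ⊆ (regular : Subalgebra k (X → k)) ∧ Z = zeroLocus k I}
    ⟨{1}, by simp, by ext; simp [zeroLocus]⟩
    (by
      intro A hA
      choose I hI hZ using fun Z (h : Z ∈ A) => hA h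
      refine ⟨⋃ Z, ⋃ h : Z ∈ A, I Z h, Set.iUnion₂_subset hI, ?_⟩
      ext x
      simp only [Set.mem_sInter, zeroLocus, Set.mem_iUnion, Set.mem_ofPred_eq]
      constructor
      · rintro h f ⟨Z, hZA, hf⟩
        have hx := h Z hZA
        rw [hZ Z hZA] at hx
        exact hx f hf
      · intro h Z hZA
        rw [hZ Z hZA]
        exact fun f hf => h f ⟨Z, hZA, hf⟩)
    (by
      rintro _ ⟨I, hI, rfl⟩ _ ⟨J, hJ, rfl⟩
      refine ⟨{p | ∃ f ∈ I, ∃ g ∈ J, p = f * g}, ?_, ?_⟩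
      · rintro _ ⟨f, hf, g, hg, rfl⟩
        exact mul_mem (hI hf) (hJ hg)
      · ext x
        simp only [zeroLocus, Set.mem_union, Set.mem_ofPred_eq]
        constructor
        · rintro (h | h) _ ⟨f, hf, g, hg, rfl⟩
          · simp [h f hf]
          · simp [h g hg]
        · intro h
          by_contra hc
          push Not at hc
          obtain ⟨⟨f, hf, hfx⟩, g, hg, hgx⟩ := hc
          exact mul_ne_zero hfx hgx (h _ ⟨f, hf, g, hg, rfl⟩))

/-- Morphisms of affine varieties: maps that pull regular functions back to regular functions. -/
def IsMorphism {X : Type v} {Y : Type w} [AffineVariety k X] [AffineVariety k Y]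
    (φ : X → Y) : Prop :=
  ∀ f ∈ (regular : Subalgebra k (Y → k)), f ∘ φ ∈ (regular : Subalgebra k (X → k))

/-- Pulling functions back along a map, as a homomorphism of algebras. -/
def pullback {X : Type v} {Y : Type w} (φ : X → Y) : (Y → k) →ₐ[k] (X → k) where
  toFun f := f ∘ φ
  map_one' := rfl
  map_mul' _ _ := rfl
  map_zero' := rfl
  map_add' _ _ := rfl
  commutes' _ := rfl

/-- The product variety: `k[X × Y]` is generated by the functions `(x, y) ↦ f x` with `f ∈ k[X]`
and `(x, y) ↦ g y` with `g ∈ k[Y]`. -/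
instance instProd (X : Type v) (Y : Type w) [AffineVariety k X] [AffineVariety k Y] :
    AffineVariety k (X × Y) where
  regular := (regular : Subalgebra k (X → k)).map (pullback k Prod.fst) ⊔
    (regular : Subalgebra k (Y → k)).map (pullback k Prod.snd)
  regular_fg := (regular_fg.map _).sup (regular_fg.map _)
  eval_bijective := by
    set A : Subalgebra k (X → k) := regular with hA
    set B : Subalgebra k (Y → k) := regular with hB
    have h₁ : ∀ f ∈ A, f ∘ Prod.fst ∈ A.map (pullback k (Prod.fst : X × Y → X)) ⊔
        B.map (pullback k (Prod.snd : X × Y → Y)) := fun f hf =>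
      (le_sup_left : A.map (pullback k (Prod.fst : X × Y → X)) ≤ _) ⟨f, hf, rfl⟩
    have h₂ : ∀ g ∈ B, g ∘ Prod.snd ∈ A.map (pullback k (Prod.fst : X × Y → X)) ⊔
        B.map (pullback k (Prod.snd : X × Y → Y)) := fun g hg =>
      (le_sup_right : B.map (pullback k (Prod.snd : X × Y → Y)) ≤ _) ⟨g, hg, rfl⟩
    constructor
    · rintro ⟨x, y⟩ ⟨x', y'⟩ h
      refine Prod.ext ((eval_bijective (k := k) (X := X)).1 ?_)
        ((eval_bijective (k := k) (X := Y)).1 ?_)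
      · ext ⟨f, hf⟩
        exact DFunLike.congr_fun h ⟨_, h₁ f hf⟩
      · ext ⟨g, hg⟩
        exact DFunLike.congr_fun h ⟨_, h₂ g hg⟩
    · intro φ
      let α : A →ₐ[k] k := φ.comp
        (((pullback k (Prod.fst : X × Y → X)).comp A.val).codRestrict _ fun f => h₁ f f.2)
      let β : B →ₐ[k] k := φ.comp
        (((pullback k (Prod.snd : X × Y → Y)).comp B.val).codRestrict _ fun g => h₂ g g.2)
      obtain ⟨x, hx⟩ := (eval_bijective (k := k) (X := X)).2 α
      obtain ⟨y, hy⟩ := (eval_bijective (k := k) (X := Y)).2 β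
      refine ⟨(x, y), ?_⟩
      have key : ∀ p (hp : p ∈ A.map (pullback k (Prod.fst : X × Y → X)) ⊔
          B.map (pullback k (Prod.snd : X × Y → Y))), p (x, y) = φ ⟨p, hp⟩ := by
        intro p hp
        have hle : A.map (pullback k (Prod.fst : X × Y → X)) ⊔
            B.map (pullback k (Prod.snd : X × Y → Y)) ≤
            (AlgHom.equalizer ((Pi.evalAlgHom k (fun _ : X × Y => k) (x, y)).comp
              (Subalgebra.val _)) φ).map (Subalgebra.val _) := by
          refine sup_le ?_ ?_
          · rintro _ ⟨f, hf, rfl⟩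
            have e : _ = _ := DFunLike.congr_fun hx ⟨f, hf⟩
            exact ⟨⟨_, h₁ f hf⟩, (AlgHom.mem_equalizer _ _ _).2 e, rfl⟩
          · rintro _ ⟨g, hg, rfl⟩
            have e : _ = _ := DFunLike.congr_fun hy ⟨g, hg⟩
            exact ⟨⟨_, h₂ g hg⟩, (AlgHom.mem_equalizer _ _ _).2 e, rfl⟩
        obtain ⟨q, hq, hqp⟩ := hle hp
        obtain rfl : q = ⟨p, hp⟩ := Subtype.ext hqp
        exact hq
      exact AlgHom.ext fun p => key p.1 p.2

/-- Let `i : S → X` be the inclusion of a locally closed subset into an affine variety.  A function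
on `S` is regular if near each point of `S` it is a quotient `a / b` of regular functions on `X`
(the sets where some `b ∈ k[X]` does not vanish form a basis of the Zariski topology). -/
def IsRegularOn {S : Type w} {X : Type v} [AffineVariety k X] (i : S → X) (φ : S → k) : Prop :=
  ∀ s : S, ∃ a ∈ (regular : Subalgebra k (X → k)), ∃ b ∈ (regular : Subalgebra k (X → k)),
    b (i s) ≠ 0 ∧ ∀ t : S, b (i t) ≠ 0 → φ t = a (i t) / b (i t)

end AffineVariety

open AffineVariety in
/-- An affine algebraic monoid over `k`: a monoid that is an affine variety and whose
multiplication `M × M → M` is a morphism of varieties. -/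
class AffineAlgebraicMonoid (k : Type u) (M : Type v) [Field k] [Monoid M]
    extends AffineVariety k M where
  isMorphism_mul : IsMorphism k (fun p : M × M => p.1 * p.2)

/-! A right action of `N` on a vector space `V` is a `Representation k Nᵐᵒᵖ V`:
`v · x` is `ρ (MulOpposite.op x) v`. -/

namespace AffineAlgebraicMonoid

open AffineVariety

variable (k : Type u) [Field k]

/-- The inclusion into `M` of a subgroup of the unit group of `M`. -/
def incl {M : Type v} [Monoid M] (H : Subgroup Mˣ) : H →* M := (Units.coeHom M).comp H.subtype

/-- `H` is closed in the unit group `G = Mˣ`, which carries the subspace topology of the Zariski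
topology of `M` (`G` is an open subvariety of `M`). -/
def IsClosedSubgroup {M : Type v} [Monoid M] [AffineAlgebraicMonoid k M]
    (H : Subgroup Mˣ) : Prop :=
  @IsClosed Mˣ ((zariski k M).induced Units.val) (H : Set Mˣ)

/-- A right `M`-module is rational if all functions `x ↦ α (v · x)` are regular on `M`. -/
def IsRationalModule {M : Type v} [Monoid M] [AffineAlgebraicMonoid k M]
    {W : Type w} [AddCommGroup W] [Module k W] (σ : Representation k Mᵐᵒᵖ W) : Prop :=
  ∀ (α : Module.Dual k W) (v : W),
    (fun x : M => α (σ (MulOpposite.op x) v)) ∈ (regular : Subalgebra k (M → k))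

variable {k}

/-- A right `H`-module is rational if all functions `x ↦ α (v · x)` are regular on `H`. -/
def IsRationalSubgroupModule {M : Type v} [Monoid M] [AffineAlgebraicMonoid k M]
    {H : Subgroup Mˣ} {V : Type w} [AddCommGroup V] [Module k V]
    (ρ : Representation k Hᵐᵒᵖ V) : Prop :=
  ∀ (α : Module.Dual k V) (v : V),
    IsRegularOn k (incl H) (fun x : H => α (ρ (MulOpposite.op x) v))

/-- A (rational) character of `H`, i.e. a morphism of algebraic groups from `H` to the
multiplicative group. -/
def IsCharacter {M : Type v} [Monoid M] [AffineAlgebraicMonoid k M]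
    {H : Subgroup Mˣ} (χ : H →* kˣ) : Prop :=
  IsRegularOn k (incl H) (fun x : H => (χ x : k))

/-- The right translate `f · x` of a function `f` on `M`: `(f · x) m = f (x m)`. -/
def rightTranslate {M : Type v} [Monoid M] (f : M → k) (x : M) : M → k := fun m => f (x * m)

/-- A character `χ` of `H` is extendible if there is a nonzero `f ∈ k[M]` with
`f · x = χ(x) f` for all `x ∈ H`. -/
def IsExtendible {M : Type v} [Monoid M] [AffineAlgebraicMonoid k M]
    {H : Subgroup Mˣ} (χ : H →* kˣ) : Prop :=
  IsCharacter χ ∧ ∃ f ∈ (regular : Subalgebra k (M → k)), f ≠ 0 ∧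
    ∀ x : H, rightTranslate f (incl H x) = (χ x : k) • f

/-- The restriction `W|_H` to `H` of a right `M`-module. -/
def restrict {M : Type v} [Monoid M] (H : Subgroup Mˣ)
    {W : Type w} [AddCommGroup W] [Module k W] (σ : Representation k Mᵐᵒᵖ W) :
    Representation k Hᵐᵒᵖ W :=
  σ.comp (incl H).op

/-- The twist `V_χ` of a right module by a character: `v ⋆ g = χ(g) (v · g)`. -/
def twist {G : Type v} [Group G] {V : Type w} [AddCommGroup V] [Module k V]
    (ρ : Representation k Gᵐᵒᵖ V) (χ : G →* kˣ) : Representation k Gᵐᵒᵖ V where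
  toFun g := (χ g.unop : k) • ρ g
  map_one' := by simp
  map_mul' g h := by
    ext v
    simp [smul_smul]

end AffineAlgebraicMonoid

/-! The unit group is the non-vanishing locus of a multiplicative `δ ∈ k[M]`, the determinant of the
action of `M` on a finite-dimensional translation-stable space generating `k[M]`. Hence a power `δ ^
n` clears the denominators of all matrix coefficients of `V`, which then extend from `H` to `M`.
This gives linear maps `L i : V → k[M]` that are jointly injective but `H`-equivariant, up to `δ ^
n`, only modulo functions vanishing on `H`.

To divide by such functions inside functions, let `N` be the finite-dimensional `H`-module of those
among the translates of the extended coefficients, with basis `b₁, …, b_r`. The map `e ↦ e ∧ b₁ ∧ ⋯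
∧ b_r` has kernel `N` on these translates, and is equivariant up to the character `χ = det N` of
`H`. Wedges are realised as determinants, that is, functions on `M^(r+1)`; a similar determinant of
the `bᵢ` alone extends `χ` to `M`. The `M`-translates of the image of `V` span `W`, and the twist is
by the inverse of `χ δ^n`. The carriers are `exists_monoidHom_isUnit_iff`,
`exists_matrixCoefficients_extend` and `exists_determinantal_embedding`. -/

/-! ### Linear and commutative algebra. -/

/-- A linear form killing all vectors `(e i s)ᵢ` is a linear relation among the `e i`, so these
vectors span `k^d` and contain a basis. -/
theorem exists_det_ne_zero_of_linearIndependent {k : Type*} [Field k] {S : Type*} {d : ℕ}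
    {e : Fin d → S → k} (he : LinearIndependent k e) :
    ∃ s : Fin d → S, Matrix.detRowAlternating (fun i => e i ∘ s) ≠ 0 := by
  have hspan : Submodule.span k (Set.range fun (s : S) (i : Fin d) => e i s) = ⊤ := by
    by_contra hne
    obtain ⟨f, hf, hle⟩ := Submodule.exists_le_ker_of_lt_top _ (lt_top_iff_ne_top.2 hne)
    refine hf (LinearMap.pi_ext' fun i => LinearMap.ext_ring ?_)
    refine Fintype.linearIndependent_iff.1 he (fun i => f (Pi.single i 1)) (funext fun s => ?_) i
    have hs : f (fun i => e i s) = 0 := hle (Submodule.subset_span ⟨s, rfl⟩)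
    rw [LinearMap.pi_apply_eq_sum_univ f] at hs
    simp only [Finset.sum_apply, Pi.smul_apply, smul_eq_mul, Pi.zero_apply]
    rw [← hs]
    refine Finset.sum_congr rfl fun j _ => ?_
    rw [smul_eq_mul, mul_comm]
    congr 2
    ext l
    simp [Pi.single_apply, eq_comm]
  obtain ⟨f, hf, -, hli⟩ := Submodule.exists_fun_fin_finrank_span_eq k
    (Set.range fun (s : S) (i : Fin d) => e i s)
  have hd : Module.finrank k
      (Submodule.span k (Set.range fun (s : S) (i : Fin d) => e i s)) = d := by
    rw [hspan]; simp
  have hli' : LinearIndependent k (fun i : Fin d => f (Fin.cast hd.symm i)) :=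
    hli.comp _ (Fin.cast_injective _)
  choose s hs using fun i : Fin d => hf (Fin.cast hd.symm i)
  refine ⟨s, ?_⟩
  have hu : IsUnit (Matrix.of fun i j => e j (s i)) := by
    rw [← Matrix.linearIndependent_rows_iff_isUnit]
    convert hli' using 1
    ext i j
    exact congrFun (hs i) j
  rw [Matrix.isUnit_iff_isUnit_det, ← Matrix.det_transpose] at hu
  exact hu.ne_zero

/-- The kernels of the powers of `f` stabilise at some `n`; an element of `ker f` is `f ^ n` of some
`y`, and `y ∈ ker f ^ (n + 1) = ker f ^ n`. -/
theorem RingHom.injective_of_surjective_of_isNoetherianRing {R : Type*} [CommRing R]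
    [IsNoetherianRing R] (f : R →+* R) (hf : Function.Surjective f) : Function.Injective f := by
  let K : ℕ →o Ideal R := ⟨fun n => RingHom.ker (f ^ n), monotone_nat_of_le_succ fun n x hx => by
    rw [RingHom.mem_ker] at hx ⊢
    rw [pow_succ', RingHom.mul_def, RingHom.comp_apply, hx, map_zero]⟩
  obtain ⟨n, hn⟩ := monotone_stabilizes_iff_noetherian.2 ‹IsNoetherianRing R› K
  rw [injective_iff_map_eq_zero]
  intro x hx
  have hs : Function.Surjective (f ^ n) := by
    rw [RingHom.coe_pow]
    exact hf.iterate n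
  obtain ⟨y, rfl⟩ := hs x
  have hy : y ∈ K (n + 1) := by
    change (f ^ (n + 1)) y = 0
    rwa [pow_succ', RingHom.mul_def, RingHom.comp_apply]
  rw [← hn (n + 1) n.le_succ] at hy
  exact hy

theorem AlternatingMap.map_endomorphism_comp_basis {R N ι : Type*} [CommRing R] [AddCommGroup N]
    [Module R N] [Fintype ι] [DecidableEq ι] (g : N [⋀^ι]→ₗ[R] R) (b : Module.Basis ι R N)
    (f : Module.End R N) : g (f ∘ b) = LinearMap.det f * g b := by
  rw [g.eq_smul_basis_det b]
  simp [b.det_comp, b.det_self, mul_comm]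

/-- Nullstellensatz: `R` is Jacobson, so the radical is an intersection of maximal ideals, and every
residue field is `k`. -/
theorem Ideal.exists_pow_mem_of_forall_algHom {k : Type u} [Field k] [IsAlgClosed k] {R : Type v}
    [CommRing R] [Algebra k R] [Algebra.FiniteType k R] (J : Ideal R) (f : R)
    (h : ∀ φ : R →ₐ[k] k, (∀ g ∈ J, φ g = 0) → φ f = 0) : ∃ n : ℕ, f ^ n ∈ J := by
  have : IsJacobsonRing R := isJacobsonRing_of_finiteType (A := k)
  change f ∈ J.radical
  rw [Ideal.radical_eq_jacobson, Ideal.jacobson, Ideal.mem_sInf]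
  rintro m ⟨hJm, hm⟩
  let _ : Field (R ⧸ m) := Ideal.Quotient.field m
  have : Algebra.FiniteType k (R ⧸ m) :=
    Algebra.FiniteType.of_surjective (Ideal.Quotient.mkₐ k m) (Ideal.Quotient.mkₐ_surjective k m)
  have : Module.Finite k (R ⧸ m) := finite_of_finite_type_of_isJacobsonRing k (R ⧸ m)
  have hb := IsAlgClosed.algebraMap_bijective_of_isIntegral (k := k) (K := R ⧸ m)
  let e : k ≃ₐ[k] R ⧸ m := AlgEquiv.ofBijective (Algebra.ofId k (R ⧸ m)) hb
  have := h ((e.symm : R ⧸ m →ₐ[k] k).comp (Ideal.Quotient.mkₐ k m)) fun g hg => by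
    have : Ideal.Quotient.mkₐ k m g = 0 := Ideal.Quotient.eq_zero_iff_mem.2 (hJm hg)
    rw [AlgHom.comp_apply, this, map_zero]
  rw [AlgHom.comp_apply] at this
  exact Ideal.Quotient.eq_zero_iff_mem.1 ((map_eq_zero_iff _ e.symm.injective).1 this)

/-! ### Clearing denominators of regular functions. -/

namespace AffineVariety

variable {k : Type u} [Field k]

theorem exists_pow_mul_eq_of_isRegularOn [IsAlgClosed k] {S : Type w} {X : Type v}
    [AffineVariety k X] {i : S → X} {φ : S → k} (hφ : IsRegularOn k i φ) {δ : X → k}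
    (hδ : δ ∈ (regular : Subalgebra k (X → k)))
    (h : ∀ x, (∀ f ∈ (regular : Subalgebra k (X → k)), (∀ s, f (i s) = 0) → f x = 0) →
      δ x ≠ 0 → x ∈ Set.range i) :
    ∃ n : ℕ, ∃ a ∈ (regular : Subalgebra k (X → k)), ∀ s, a (i s) = δ (i s) ^ n * φ s := by
  have : Algebra.FiniteType k (regular : Subalgebra k (X → k)) :=
    (Subalgebra.fg_iff_finiteType _).1 regular_fg
  -- The ideal of denominators of `φ`. It contains all functions vanishing on `S` (numerator `0`),
  -- so by `h` its zeros with `δ ≠ 0` come from `S`, where local denominators exclude them.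
  let J : Ideal (regular : Subalgebra k (X → k)) :=
    { carrier := {b | ∃ a ∈ (regular : Subalgebra k (X → k)), ∀ s, a (i s) = b.1 (i s) * φ s}
      add_mem' := by
        rintro b b' ⟨a, ha, hab⟩ ⟨a', ha', hab'⟩
        exact ⟨a + a', add_mem ha ha', fun s => by simp [hab, hab', add_mul]⟩
      zero_mem' := ⟨0, zero_mem _, by simp⟩
      smul_mem' := by
        rintro c b ⟨a, ha, hab⟩
        exact ⟨c.1 * a, mul_mem c.2 ha, fun s => by simp [hab, mul_assoc]⟩ }
  obtain ⟨n, a, ha, hn⟩ := J.exists_pow_mem_of_forall_algHom (k := k) ⟨δ, hδ⟩ (by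
    intro ψ hψ
    obtain ⟨x, rfl⟩ := eval_bijective.2 ψ
    change δ x = 0
    by_contra hx
    obtain ⟨s, rfl⟩ := h x (fun f hf hfs => hψ ⟨f, hf⟩ ⟨0, zero_mem _, by simp [hfs]⟩) hx
    obtain ⟨a, ha, b, hb, hbs, hab⟩ := hφ s
    -- The square is needed: with numerator `a * b` the identity also holds where `b` vanishes and
    -- `a / b` says nothing about `φ`.
    have : b (i s) * b (i s) = 0 := by
      refine hψ ⟨b * b, mul_mem hb hb⟩ ⟨a * b, mul_mem ha hb, fun t => ?_⟩
      by_cases hbt : b (i t) = 0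
      · simp [hbt]
      · simp only [Pi.mul_apply, hab t hbt]
        field_simp
    exact hbs (mul_self_eq_zero.1 this))
  exact ⟨n, a, ha, hn⟩

end AffineVariety

theorem Subalgebra.det_mem {R X ι : Type*} [CommRing R] [Fintype ι] [DecidableEq ι]
    (A : Subalgebra R (X → R)) {P : X → Matrix ι ι R} (hP : ∀ i j, (fun x => P x i j) ∈ A) :
    (fun x => (P x).det) ∈ A := by
  have : (fun x => (P x).det) =
      ∑ p : Equiv.Perm ι, (Equiv.Perm.sign p : ℤ) • ∏ i, fun x => P x (p i) i := by
    ext x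
    simp [Matrix.det_apply, Units.smul_def]
  rw [this]
  exact sum_mem fun p _ => zsmul_mem (prod_mem fun i _ => hP _ _) _

namespace AffineAlgebraicMonoid

open AffineVariety

/-! ### Spaces of translates and rational modules. -/

section translates

variable {k : Type u} [Field k] {M : Type v} [Monoid M] {S : Type w} [MulAction M S]

variable (k M) in
/-- The linear span of the translates `s ↦ F (x • s)`, `x ∈ M`, of the functions `F ∈ T`. -/
def translates (T : Set (S → k)) : Submodule k (S → k) :=
  Submodule.span k {g | ∃ F ∈ T, ∃ x : M, g = fun s => F (x • s)}

theorem subset_translates (T : Set (S → k)) : T ⊆ translates k M T := fun F hF =>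
  Submodule.subset_span ⟨F, hF, 1, by simp⟩

theorem translates_le_comap (T : Set (S → k)) (x : M) :
    translates k M T ≤ (translates k M T).comap (LinearMap.funLeft k k (x • · : S → S)) := by
  refine Submodule.span_le.2 ?_
  rintro _ ⟨F, hF, y, rfl⟩
  refine Submodule.subset_span ⟨F, hF, y * x, ?_⟩
  ext s
  simp [LinearMap.funLeft_apply, mul_smul]

/-- The right action of `M` on `translates k M T`. -/
def translatesRep (T : Set (S → k)) : Representation k Mᵐᵒᵖ (translates k M T) where
  toFun x := (LinearMap.funLeft k k (x.unop • · : S → S)).restrict (translates_le_comap T x.unop)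
  map_one' := by
    ext F s
    simp [LinearMap.funLeft_apply]
  map_mul' x y := by
    ext F s
    simp [LinearMap.funLeft_apply, mul_smul]

end translates

variable {k : Type u} [Field k] {M : Type v} [Monoid M] [AffineAlgebraicMonoid k M]

/-- In finite dimension a separating family spans the dual. For spaces of functions the point
evaluations serve as `β`. -/
theorem isRationalModule_of_separating {W : Type*} [AddCommGroup W] [Module k W]
    [FiniteDimensional k W] {σ : Representation k Mᵐᵒᵖ W} {ι : Type*} (β : ι → Module.Dual k W)
    (hsep : ∀ w, (∀ i, β i w = 0) → w = 0)
    (hreg : ∀ i w, (fun x : M => β i (σ (MulOpposite.op x) w)) ∈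
      (regular : Subalgebra k (M → k))) : IsRationalModule k σ := by
  intro α v
  have hα : α ∈ Submodule.span k (Set.range β) := by
    rw [← Subspace.dualCoannihilator_dualAnnihilator_eq (W := Submodule.span k (Set.range β)),
      Submodule.mem_dualAnnihilator]
    intro w hw
    rw [← SetLike.mem_coe, Submodule.coe_dualCoannihilator_span] at hw
    rw [hsep w fun i => hw _ ⟨i, rfl⟩, map_zero]
  induction hα using Submodule.span_induction with
  | mem x hx => obtain ⟨i, rfl⟩ := hx; exact hreg i v
  | zero => exact zero_mem regular
  | add x y _ _ hx hy => exact add_mem hx hy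
  | smul c x _ hx => exact Subalgebra.smul_mem _ hx c

theorem det_mem_regular {W : Type*} [AddCommGroup W] [Module k W]
    [FiniteDimensional k W] {σ : Representation k Mᵐᵒᵖ W} (hσ : IsRationalModule k σ) :
    (fun x : M => LinearMap.det (σ (MulOpposite.op x))) ∈ (regular : Subalgebra k (M → k)) := by
  let b := Module.finBasis k W
  simp_rw [← LinearMap.det_toMatrix b]
  refine Subalgebra.det_mem _ fun i j => ?_
  simp only [LinearMap.toMatrix_apply]
  exact hσ (b.coord i) (b j)

theorem comp_mul_left_mem_regular {f : M → k} (hf : f ∈ (regular : Subalgebra k (M → k))) (x : M) :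
    (fun m => f (x * m)) ∈ (regular : Subalgebra k (M → k)) := by
  have h : (regular : Subalgebra k (M × M → k)) ≤
      (regular : Subalgebra k (M → k)).comap (pullback k fun m => (x, m)) := by
    refine sup_le ?_ ?_
    · rintro _ ⟨g, -, rfl⟩
      exact Subalgebra.algebraMap_mem regular (g x)
    · rintro _ ⟨g, hg, rfl⟩
      exact hg
  exact h (isMorphism_mul f hf)

/-! ### Representative functions and local finiteness. -/

variable {S : Type w} [MulAction M S]

variable (k M S) in
/-- The functions `F` on a left `M`-set `S` for which `(x, s) ↦ F (x • s)` is a finite sum of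
products of regular functions of `x` and functions of `s`. -/
def representative : Subalgebra k (S → k) :=
  ((regular : Subalgebra k (M → k)).map (pullback k (Prod.fst : M × S → M)) ⊔
    (⊤ : Subalgebra k (S → k)).map (pullback k (Prod.snd : M × S → S))).comap
      (pullback k fun p : M × S => p.1 • p.2)

theorem comp_mem_representative {T : Type*} [MulAction M T] {F : S → k}
    (hF : F ∈ representative k M S) (φ : T → S) (hφ : ∀ (x : M) t, φ (x • t) = x • φ t) :
    F ∘ φ ∈ representative k M T := by
  have h : (regular : Subalgebra k (M → k)).map (pullback k (Prod.fst : M × S → M)) ⊔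
      (⊤ : Subalgebra k (S → k)).map (pullback k (Prod.snd : M × S → S)) ≤
      ((regular : Subalgebra k (M → k)).map (pullback k (Prod.fst : M × T → M)) ⊔
        (⊤ : Subalgebra k (T → k)).map (pullback k (Prod.snd : M × T → T))).comap
          (pullback k (Prod.map id φ)) := by
    refine sup_le ?_ ?_
    · rintro _ ⟨g, hg, rfl⟩
      exact Algebra.mem_sup_left ⟨g, hg, rfl⟩
    · rintro _ ⟨g, -, rfl⟩
      exact Algebra.mem_sup_right ⟨g ∘ φ, trivial, rfl⟩
  have := h hF
  rw [Subalgebra.mem_comap] at this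
  rw [representative, Subalgebra.mem_comap]
  convert this using 1
  ext p
  exact congrArg F (hφ p.1 p.2)

theorem regular_le_representative : regular ≤ representative k M M := fun f hf =>
  sup_le_sup_left (Subalgebra.map_mono le_top) _ (isMorphism_mul f hf)

theorem representative.orbit_mem_regular {F : S → k} (hF : F ∈ representative k M S) (s : S) :
    (fun x : M => F (x • s)) ∈ (regular : Subalgebra k (M → k)) := by
  have h : (regular : Subalgebra k (M → k)).map (pullback k (Prod.fst : M × S → M)) ⊔
      (⊤ : Subalgebra k (S → k)).map (pullback k (Prod.snd : M × S → S)) ≤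
      (regular : Subalgebra k (M → k)).comap (pullback k fun m => (m, s)) := by
    refine sup_le ?_ ?_
    · rintro _ ⟨g, hg, rfl⟩
      exact hg
    · rintro _ ⟨g, -, rfl⟩
      exact Subalgebra.algebraMap_mem regular (g s)
  exact h hF

/-- If `F (x • s) = ∑ fᵢ(x) gᵢ(s)`, every translate of `F` lies in the span of the `gᵢ`. -/
theorem representative.exists_finiteDimensional {F : S → k} (hF : F ∈ representative k M S) :
    ∃ U : Submodule k (S → k), FiniteDimensional k U ∧ ∀ x : M, (fun s => F (x • s)) ∈ U := by
  have h : ∀ p ∈ (regular : Subalgebra k (M → k)).map (pullback k (Prod.fst : M × S → M)) ⊔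
      (⊤ : Subalgebra k (S → k)).map (pullback k (Prod.snd : M × S → S)),
      ∃ U : Submodule k (S → k), FiniteDimensional k U ∧ ∀ x : M, (fun s => p (x, s)) ∈ U := by
    intro p hp
    rw [← Subalgebra.mem_toSubmodule, ← Subalgebra.mul_toSubmodule] at hp
    induction hp using Submodule.mul_induction_on' with
    | mem_mul_mem p hp q hq =>
      obtain ⟨f, -, rfl⟩ := hp
      obtain ⟨g, -, rfl⟩ := hq
      exact ⟨k ∙ g, inferInstance, fun x => Submodule.mem_span_singleton.2 ⟨f x, rfl⟩⟩
    | add p _ q _ hp hq =>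
      obtain ⟨U, hU, hp⟩ := hp
      obtain ⟨U', hU', hq⟩ := hq
      exact ⟨U ⊔ U', inferInstance, fun x =>
        add_mem (Submodule.mem_sup_left (hp x)) (Submodule.mem_sup_right (hq x))⟩
  exact h _ hF

theorem finiteDimensional_translates {T : Set (S → k)} (hT : T.Finite)
    (hTr : T ⊆ representative k M S) : FiniteDimensional k (translates k M T) := by
  have : Finite T := hT
  choose U hU hmem using fun F : T => representative.exists_finiteDimensional (hTr F.2)
  refine Submodule.finiteDimensional_of_le (S₂ := ⨆ F, U F) (Submodule.span_le.2 ?_)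
  rintro _ ⟨F, hF, x, rfl⟩
  exact Submodule.mem_iSup_of_mem ⟨F, hF⟩ (hmem ⟨F, hF⟩ x)

theorem translates_orbit_mem_regular {T : Set (S → k)} (hTr : T ⊆ representative k M S)
    {F : S → k} (hF : F ∈ translates k M T) (s : S) :
    (fun x : M => F (x • s)) ∈ (regular : Subalgebra k (M → k)) := by
  induction hF using Submodule.span_induction with
  | mem F hF =>
    obtain ⟨F, hF, y, rfl⟩ := hF
    simp only [← mul_smul]
    exact comp_mul_left_mem_regular (representative.orbit_mem_regular (hTr hF) s) y
  | zero => exact zero_mem regular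
  | add x y _ _ hx hy => exact add_mem hx hy
  | smul c x _ hx => exact Subalgebra.smul_mem _ hx c

theorem isRationalModule_translatesRep {T : Set (S → k)} (hT : T.Finite)
    (hTr : T ⊆ representative k M S) : IsRationalModule k (translatesRep (k := k) (M := M) T) := by
  have := finiteDimensional_translates hT hTr
  exact isRationalModule_of_separating
    (fun s : S => (LinearMap.proj s : (S → k) →ₗ[k] k) ∘ₗ (translates k M T).subtype)
    (fun F hF => Subtype.ext (funext hF)) fun s F => translates_orbit_mem_regular hTr F.2 s

/-! ### The unit group as a principal open set. -/

theorem translates_le_regular {T : Set (M → k)} (hT : T ⊆ (regular : Subalgebra k (M → k))) :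
    translates k M T ≤ Subalgebra.toSubmodule (regular : Subalgebra k (M → k)) := by
  refine Submodule.span_le.2 ?_
  rintro _ ⟨F, hF, x, rfl⟩
  exact comp_mul_left_mem_regular (hT hF) x

/-- The comorphism `r` of left multiplication by `x` reaches the generators `T`, so it is
surjective, hence an automorphism of the Noetherian ring `k[M]`. -/
theorem isUnit_of_translatesRep_surjective {T : Set (M → k)}
    (hT : Algebra.adjoin k T = regular) (x : M)
    (hx : Function.Surjective (translatesRep (k := k) T (MulOpposite.op x))) : IsUnit x := by
  have : Algebra.FiniteType k (regular : Subalgebra k (M → k)) :=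
    (Subalgebra.fg_iff_finiteType _).1 regular_fg
  have : IsNoetherianRing (regular : Subalgebra k (M → k)) :=
    Algebra.FiniteType.isNoetherianRing k _
  let r : (regular : Subalgebra k (M → k)) →ₐ[k] (regular : Subalgebra k (M → k)) :=
    ((pullback k (x * · : M → M)).comp (Subalgebra.val _)).codRestrict _
      fun f => comp_mul_left_mem_regular f.2 x
  have hreg : T ⊆ (regular : Subalgebra k (M → k)) := hT ▸ Algebra.subset_adjoin
  have hsurj : Function.Surjective r := by
    have hle : (regular : Subalgebra k (M → k)) ≤ r.range.map (Subalgebra.val _) := by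
      refine hT.symm.trans_le (Algebra.adjoin_le fun f hf => ?_)
      obtain ⟨g, hg⟩ := hx ⟨f, subset_translates T hf⟩
      refine ⟨⟨f, hreg hf⟩, ⟨⟨g, translates_le_regular hreg g.2⟩, Subtype.ext ?_⟩, rfl⟩
      exact (congrArg Subtype.val hg :)
    intro f
    obtain ⟨g, ⟨g', rfl⟩, hg⟩ := hle f.2
    exact ⟨g', Subtype.ext hg⟩
  have hinj : Function.Injective r :=
    RingHom.injective_of_surjective_of_isNoetherianRing r.toRingHom hsurj
  let e := AlgEquiv.ofBijective r ⟨hinj, hsurj⟩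
  -- The point `y` is evaluation at `1` composed with the inverse of `r`.
  have hright : ∃ y, x * y = 1 := by
    obtain ⟨y, hy⟩ := (eval_bijective (k := k) (X := M)).2
      (((Pi.evalAlgHom k (fun _ : M => k) 1).comp (Subalgebra.val _)).comp
        e.symm.toAlgHom)
    refine ⟨y, (eval_bijective (k := k) (X := M)).1 (AlgHom.ext fun f => ?_)⟩
    have := DFunLike.congr_fun hy (r f)
    simp only [AlgHom.comp_apply] at this
    rw [show e.symm.toAlgHom (r f) = f from e.symm_apply_apply f] at this
    exact this
  have hleft : Function.Injective (x * · : M → M) := by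
    intro y z hyz
    refine (eval_bijective (k := k) (X := M)).1 (AlgHom.ext fun f => ?_)
    obtain ⟨g, rfl⟩ := hsurj f
    exact congrArg g.1 hyz
  obtain ⟨y, hy⟩ := hright
  exact ⟨⟨x, y, hy, hleft (by simp only [← mul_assoc, hy, one_mul, mul_one])⟩, rfl⟩

variable (k M) in
/-- There is a multiplicative regular function on `M` whose non-vanishing locus is the unit
group. -/
theorem exists_monoidHom_isUnit_iff : ∃ δ : M →* k,
    (δ : M → k) ∈ (regular : Subalgebra k (M → k)) ∧ ∀ x, δ x ≠ 0 → IsUnit x := by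
  obtain ⟨T, hT⟩ := regular_fg (k := k) (X := M)
  have hreg : (T : Set (M → k)) ⊆ representative k M M := fun f hf =>
    regular_le_representative (hT ▸ Algebra.subset_adjoin hf)
  have := finiteDimensional_translates T.finite_toSet hreg
  refine ⟨⟨⟨fun x => LinearMap.det (translatesRep (k := k) (T : Set (M → k)) (MulOpposite.op x)),
    by simp⟩, fun x y => by simp [mul_comm]⟩,
    det_mem_regular (isRationalModule_translatesRep T.finite_toSet hreg), fun x hx => ?_⟩
  refine isUnit_of_translatesRep_surjective hT x ?_
  exact ((Module.End.isUnit_iff _).1 ((LinearMap.isUnit_iff_isUnit_det _).2 (Ne.isUnit hx))).2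

theorem mem_of_isClosedSubgroup {H : Subgroup Mˣ} (hH : IsClosedSubgroup k H) {x : Mˣ}
    (hx : ∀ f ∈ (regular : Subalgebra k (M → k)), (∀ h : H, f (incl H h) = 0) → f x = 0) :
    x ∈ H := by
  obtain ⟨Z, hZ, hZH⟩ := (@isClosed_induced_iff Mˣ M (zariski k M) _ _).1 hH
  obtain ⟨I, hI, hZI⟩ : Zᶜᶜ ∈ {Z | ∃ I : Set (M → k),
      I ⊆ (regular : Subalgebra k (M → k)) ∧ Z = zeroLocus k I} :=
    (@isOpen_compl_iff M Z (zariski k M)).2 hZ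
  rw [compl_compl] at hZI
  have hmem : ∀ y : Mˣ, y ∈ H ↔ ∀ f ∈ I, f y = 0 := fun y => by
    rw [← SetLike.mem_coe, ← hZH, hZI]
    rfl
  exact (hmem x).2 fun f hf => hx f (hI hf) fun h => (hmem h).1 h.2 f hf

/-! ### Functions vanishing on `H`, and the determinantal quotient. -/

section vanishing

variable {k : Type u} [Field k] {M : Type v} [Monoid M]

/-- The functions in `translates k M T` that vanish on `H`. -/
def vanishingTranslates (T : Set (M → k)) (H : Subgroup Mˣ) : Submodule k (M → k) :=
  translates k M T ⊓ LinearMap.ker (LinearMap.funLeft k k (incl H))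

theorem vanishingTranslates_le_comap (T : Set (M → k)) (H : Subgroup Mˣ) (x : H) :
    vanishingTranslates T H ≤
      (vanishingTranslates T H).comap (LinearMap.funLeft k k (incl H x * · : M → M)) := by
  rintro f ⟨hf, hfH⟩
  refine ⟨translates_le_comap T (incl H x) hf, funext fun h => ?_⟩
  have := congrFun (LinearMap.mem_ker.1 hfH) (x * h)
  simpa [LinearMap.funLeft_apply] using this

/-- The right action of `H` on the functions in `translates k M T` that vanish on `H`. -/
def vanishingTranslatesRep (T : Set (M → k)) (H : Subgroup Mˣ) :
    Representation k Hᵐᵒᵖ (vanishingTranslates T H) where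
  toFun x := (LinearMap.funLeft k k (incl H x.unop * · : M → M)).restrict
    (vanishingTranslates_le_comap T H x.unop)
  map_one' := by
    ext F s
    simp [LinearMap.funLeft_apply]
  map_mul' x y := by
    ext F s
    simp [LinearMap.funLeft_apply, mul_assoc]

end vanishing

variable {k : Type u} [Field k] {M : Type v} [Monoid M] [AffineAlgebraicMonoid k M]

theorem mem_representative_of_invariant {S : Type*} [MulAction M S] {F : S → k}
    (hF : ∀ (x : M) s, F (x • s) = F s) : F ∈ representative k M S := by
  rw [representative, Subalgebra.mem_comap]
  refine Algebra.mem_sup_right ⟨F, trivial, ?_⟩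
  ext p
  exact (hF p.1 p.2).symm

theorem representative_sigma {ι S : Type*} [Fintype ι] [DecidableEq ι] [MulAction M S]
    {F : ι → S → k} (hF : ∀ i, F i ∈ representative k M S) :
    (fun s : Σ _ : ι, S => F s.1 s.2) ∈ representative k M (Σ _ : ι, S) := by
  have : (fun s : Σ _ : ι, S => F s.1 s.2) =
      ∑ i, (fun s : Σ _ : ι, S => if s.1 = i then (1 : k) else 0) *
        (F i ∘ fun s : Σ _ : ι, S => s.2) := by
    ext s
    simp
  rw [this]
  exact sum_mem fun i _ => mul_mem (mem_representative_of_invariant fun _ _ => rfl)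
    (comp_mem_representative (hF i) _ fun _ _ => rfl)

theorem exists_matrixCoefficients_extend [IsAlgClosed k] {H : Subgroup Mˣ}
    (hH : IsClosedSubgroup k H) {δ : M →* k} (hδ : (δ : M → k) ∈ (regular : Subalgebra k (M → k)))
    (hδu : ∀ x, δ x ≠ 0 → IsUnit x) {V : Type w} [AddCommGroup V] [Module k V]
    {ρ : Representation k Hᵐᵒᵖ V} (hρ : IsRationalSubgroupModule ρ) {ι : Type*} [Fintype ι]
    (b : Module.Basis ι k V) :
    ∃ (n : ℕ) (a : ι → ι → M → k), (∀ i j, a i j ∈ (regular : Subalgebra k (M → k))) ∧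
      ∀ i j (h : H), a i j (incl H h) =
        δ (incl H h) ^ n * b.coord i (ρ (MulOpposite.op h) (b j)) := by
  have key : ∀ i j, ∃ n : ℕ, ∃ a ∈ (regular : Subalgebra k (M → k)), ∀ h : H,
      a (incl H h) = δ (incl H h) ^ n * b.coord i (ρ (MulOpposite.op h) (b j)) := fun i j =>
    exists_pow_mul_eq_of_isRegularOn (hρ (b.coord i) (b j)) hδ fun x hx hδx => by
      obtain ⟨y, rfl⟩ := hδu x hδx
      exact ⟨⟨y, mem_of_isClosedSubgroup hH hx⟩, rfl⟩
  choose n a ha hna using key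
  have hle : ∀ i j, n i j ≤ ∑ i, ∑ j, n i j := fun i j =>
    (Finset.single_le_sum (f := n i) (fun _ _ => Nat.zero_le _) (Finset.mem_univ j)).trans
      (Finset.single_le_sum (f := fun i => ∑ j, n i j) (fun _ _ => Nat.zero_le _)
        (Finset.mem_univ i))
  -- The sum of all exponents dominates each of them; surplus powers of `δ` are absorbed into the
  -- coefficients.
  refine ⟨∑ i, ∑ j, n i j, fun i j => (δ : M → k) ^ (∑ i, ∑ j, n i j - n i j) * a i j,
    fun i j => mul_mem (pow_mem hδ _) (ha i j), fun i j h => ?_⟩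
  simp only [Pi.mul_apply, Pi.pow_apply, hna]
  rw [← mul_assoc, ← pow_add, Nat.sub_add_cancel (hle i j)]

/-- Determinants embed the quotient of `translates k M T` by its subspace of functions vanishing on
`H` into the functions on a power of `M`, equivariantly up to an extendible character of `H`. -/
theorem exists_determinantal_embedding {T : Set (M → k)} (hT : T.Finite)
    (hTr : T ⊆ (regular : Subalgebra k (M → k))) (H : Subgroup Mˣ) :
    ∃ (d : ℕ) (D : (M → k) →ₗ[k] ((Fin d → M) → k)) (χ : H →* kˣ) (f : M → k),
      f ∈ (regular : Subalgebra k (M → k)) ∧ f 1 ≠ 0 ∧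
      (∀ (x : H) m, f (incl H x * m) = χ x * f m) ∧
      (∀ e ∈ (regular : Subalgebra k (M → k)), D e ∈ representative k M (Fin d → M)) ∧
      (∀ e ∈ translates k M T, D e = 0 ↔ ∀ h, e (incl H h) = 0) ∧
      ∀ e (x : H) s, D e (incl H x • s) = χ x * D (fun m => e (incl H x * m)) s := by
  have hreg := translates_le_regular hTr
  have := finiteDimensional_translates hT (hTr.trans regular_le_representative)
  have : FiniteDimensional k (vanishingTranslates T H) :=
    Submodule.finiteDimensional_of_le inf_le_left
  set N := vanishingTranslates T H
  let b := Module.finBasis k N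
  have hb : ∀ i, (b i : M → k) ∈ (regular : Subalgebra k (M → k)) := fun i =>
    hreg (b i).2.1
  have hbli : LinearIndependent k fun i => (b i : M → k) :=
    b.linearIndependent.map' N.subtype N.ker_subtype
  have hbspan : Submodule.span k (Set.range fun i => (b i : M → k)) = N := by
    have : (Set.range fun i => (b i : M → k)) = N.subtype '' Set.range b := by
      rw [← Set.range_comp]; rfl
    rw [this, Submodule.span_image, b.span_eq, Submodule.map_subtype_top]
  let τ := vanishingTranslatesRep T H
  -- `D e` is the determinant with first row `e` and remaining rows the basis of `N`, all evaluated
  -- at the points of `s`: the wedge `e ∧ b₁ ∧ ⋯ ∧ b_r` as a function.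
  let D : (M → k) →ₗ[k] ((Fin (Module.finrank k N + 1) → M) → k) :=
    { toFun e s := Matrix.detRowAlternating.curryLeft (e ∘ s) fun i => (b i : M → k) ∘ s
      map_add' e e' := funext fun s => DFunLike.congr_fun
        (map_add (Matrix.detRowAlternating (R := k)).curryLeft (e ∘ s) (e' ∘ s)) _
      map_smul' c e := funext fun s => DFunLike.congr_fun
        (map_smul (Matrix.detRowAlternating (R := k)).curryLeft c (e ∘ s)) _ }
  have hD : ∀ e s, D e s = Matrix.detRowAlternating
      fun i => (Fin.cons e (fun i => (b i : M → k)) : Fin _ → M → k) i ∘ s := by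
    intro e s
    change Matrix.detRowAlternating (Matrix.vecCons _ _) = _
    congr 1
    ext i : 1
    cases i using Fin.cases <;> rfl
  obtain ⟨s₀, hs₀⟩ := exists_det_ne_zero_of_linearIndependent hbli
  -- The character is the determinant of `H` on `N`; the function `m ↦ det (bᵢ (m s₀ⱼ))` extends it
  -- and is nonzero at `1` by the choice of `s₀`.
  refine ⟨_, D, MonoidHom.toHomUnits ⟨⟨fun x => LinearMap.det (τ (MulOpposite.op x)), by simp⟩,
    fun x y => by simp [mul_comm]⟩,
    fun m => Matrix.detRowAlternating fun i => (b i : M → k) ∘ (m • s₀), ?_, ?_, ?_, ?_, ?_, ?_⟩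
  · exact Subalgebra.det_mem _ fun i j =>
      representative.orbit_mem_regular (regular_le_representative (hb i)) (s₀ j)
  · simpa using hs₀
  · intro x m
    have := (Matrix.detRowAlternating.compLinearMap
      (LinearMap.funLeft k k (m • s₀) ∘ₗ N.subtype)).map_endomorphism_comp_basis b
        (τ (MulOpposite.op x))
    simp only [mul_smul]
    exact this
  · intro e he
    have : D e = fun s => (Matrix.of fun i j =>
        (Fin.cons e (fun i => (b i : M → k)) : Fin _ → M → k) i (s j)).det := funext (hD e)
    rw [this]
    refine Subalgebra.det_mem _ fun i j => ?_
    refine comp_mem_representative (regular_le_representative (k := k) (M := M) ?_)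
      (fun s : Fin (Module.finrank k N + 1) → M => s j) fun _ _ => rfl
    cases i using Fin.cases
    exacts [he, hb _]
  · intro e he
    have hmem : e ∈ N ↔ ∀ h, e (incl H h) = 0 :=
      ⟨fun h => congrFun (LinearMap.mem_ker.1 h.2), fun h => ⟨he, funext h⟩⟩
    rw [← hmem]
    constructor
    · intro h
      by_contra hN
      obtain ⟨s, hs⟩ := exists_det_ne_zero_of_linearIndependent
        (linearIndependent_finCons.2 ⟨hbli, hbspan ▸ hN⟩)
      exact hs (by rw [← hD, h, Pi.zero_apply])
    · intro h
      ext s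
      let g : N [⋀^Fin (Module.finrank k N + 1)]→ₗ[k] k :=
        Matrix.detRowAlternating.compLinearMap (LinearMap.funLeft k k s ∘ₗ N.subtype)
      have hg : g (Fin.cons ⟨e, h⟩ b) = 0 := g.map_linearDependent _ fun hli => by
        simpa using hli.fintype_card_le_finrank
      rw [hD, Pi.zero_apply, ← hg]
      change _ = Matrix.detRowAlternating _
      congr 1
      ext i : 1
      cases i using Fin.cases <;> rfl
  · intro e x s
    -- With the translated first row fixed, the determinant is a top-degree alternating form on `N`,
    -- so translating the other rows multiplies it by `det τ(x)`.
    exact ((Matrix.detRowAlternating.curryLeft ((fun m => e (incl H x * m)) ∘ s)).compLinearMap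
      (LinearMap.funLeft k k s ∘ₗ N.subtype)).map_endomorphism_comp_basis b (τ (MulOpposite.op x))

theorem IsExtendible.of_apply_one_ne_zero {H : Subgroup Mˣ} {χ : H →* kˣ} {f : M → k}
    (hf : f ∈ (regular : Subalgebra k (M → k))) (hf1 : f 1 ≠ 0)
    (hχ : ∀ (x : H) m, f (incl H x * m) = χ x * f m) : IsExtendible (k := k) χ := by
  refine ⟨fun s => ⟨f, hf, fun _ => f 1, Subalgebra.algebraMap_mem regular (f 1), hf1,
    fun t _ => ?_⟩, f, hf, fun h => hf1 (by rw [h, Pi.zero_apply]), fun x => funext (hχ x)⟩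
  have := hχ t 1
  rw [mul_one] at this
  rw [this, mul_div_cancel_right₀ _ hf1]

/-- Transport to `k^n` brings the module into the universe of `k`. -/
theorem exists_equiv_fin_function {W : Type*} [AddCommGroup W] [Module k W]
    [FiniteDimensional k W] {σ : Representation k Mᵐᵒᵖ W} (hσ : IsRationalModule k σ) :
    ∃ (n : ℕ) (σ' : Representation k Mᵐᵒᵖ (Fin n → k)) (e : W ≃ₗ[k] (Fin n → k)),
      IsRationalModule k σ' ∧ ∀ x w, σ' x (e w) = e (σ x w) := by
  let e := (Module.finBasis k W).equivFun
  refine ⟨_, (LinearEquiv.conjAlgEquiv k e : _ →* _).comp σ, e, fun α v => ?_, fun x w => ?_⟩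
  · exact hσ (α ∘ₗ e.toLinearMap) (e.symm v)
  · simp [LinearEquiv.conjAlgEquiv]

end AffineAlgebraicMonoid

/-! ### The embedding of `V`. -/

open AffineAlgebraicMonoid in
theorem mainTheorem9
    {k : Type u} [Field k] [IsAlgClosed k]
    {M : Type v} [Monoid M] [AffineAlgebraicMonoid k M]
    (H : Subgroup Mˣ) (hH : IsClosedSubgroup k H)
    {V : Type w} [AddCommGroup V] [Module k V] [FiniteDimensional k V]
    (ρ : Representation k Hᵐᵒᵖ V) (hρ : IsRationalSubgroupModule ρ) :
    ∃ (W : Type u) (_ : AddCommGroup W) (_ : Module k W) (_ : FiniteDimensional k W)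
      (σ : Representation k Mᵐᵒᵖ W) (χ : H →* kˣ)
      (ι : Representation.IntertwiningMap ρ (twist (restrict H σ) χ⁻¹)),
      IsRationalModule k σ ∧ IsExtendible χ ∧ Function.Injective ι := by
  obtain ⟨δ, hδ, hδu⟩ := exists_monoidHom_isUnit_iff k M
  let b := Module.finBasis k V
  obtain ⟨n, a, ha, hab⟩ := exists_matrixCoefficients_extend hH hδ hδu hρ b
  let L (i) : V →ₗ[k] (M → k) := b.constr k (a i)
  have hLb : ∀ i j, L i (b j) = a i j := fun i j => b.constr_basis k (a i) j
  have hL : ∀ i v (h : H), L i v (incl H h) =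
      δ (incl H h) ^ n * b.coord i (ρ (MulOpposite.op h) v) := fun i v h =>
    LinearMap.congr_fun (f := LinearMap.proj (incl H h) ∘ₗ L i)
      (g := δ (incl H h) ^ n • (b.coord i ∘ₗ ρ (MulOpposite.op h)))
      (b.ext fun j => by simp [hLb, hab]) v
  let T : Set (M → k) := Set.range fun p : _ × _ => a p.1 p.2
  have hT : T ⊆ (AffineVariety.regular : Subalgebra k (M → k)) := by
    rintro _ ⟨p, rfl⟩
    exact ha _ _
  have hLT : ∀ i v, L i v ∈ translates k M T := fun i v => by
    rw [← b.sum_repr v, map_sum]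
    simp only [map_smul, hLb]
    exact sum_mem fun j _ => Submodule.smul_mem _ _ (subset_translates T ⟨(i, j), rfl⟩)
  obtain ⟨d, D, χ, f, hf, hf1, hfχ, hDr, hD0, hDx⟩ :=
    exists_determinantal_embedding (Set.finite_range _) hT H
  -- One copy of `M^d` for each coordinate of `V` packs all the `D (L i v)` into a single function.
  let F : V →ₗ[k] ((Σ _ : Fin (Module.finrank k V), (Fin d → M)) → k) :=
    LinearMap.pi fun s => LinearMap.proj s.2 ∘ₗ D ∘ₗ L s.1
  let R : Set ((Σ _ : Fin (Module.finrank k V), (Fin d → M)) → k) := Set.range fun j => F (b j)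
  have hR : R ⊆ representative k M (Σ _ : Fin (Module.finrank k V), (Fin d → M)) := by
    rintro _ ⟨j, rfl⟩
    exact representative_sigma fun i => hDr _ (translates_le_regular hT (hLT i (b j)))
  have hFR : ∀ v, F v ∈ translates k M R := fun v => by
    rw [← b.sum_repr v, map_sum]
    simp only [map_smul]
    exact sum_mem fun j _ => Submodule.smul_mem _ _ (subset_translates R ⟨j, rfl⟩)
  have := finiteDimensional_translates (Set.finite_range _) hR
  obtain ⟨N, σ, e, hσ, he⟩ :=
    exists_equiv_fin_function (isRationalModule_translatesRep (Set.finite_range _) hR)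
  let ψ : H →* kˣ := χ * (δ.comp (incl H)).toHomUnits ^ n
  have hψ : ∀ x, (ψ x : k) = χ x * δ (incl H x) ^ n := fun x => rfl
  have hFx : ∀ x v s, F v (incl H x • s) = ψ x * F (ρ (MulOpposite.op x) v) s := by
    rintro x v ⟨i, s⟩
    change D (L i v) (incl H x • s) = ψ x * D (L i (ρ (MulOpposite.op x) v)) s
    rw [hDx, hψ, mul_assoc]
    congr 1
    -- This failure of equivariance of `L i` vanishes on `H`, as `δ` is multiplicative, so `D` kills
    -- it.
    have hmem : (fun m => L i v (incl H x * m)) - δ (incl H x) ^ n • L i (ρ (MulOpposite.op x) v) ∈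
        translates k M T :=
      sub_mem (translates_le_comap T (incl H x) (hLT i v)) (Submodule.smul_mem _ _ (hLT _ _))
    have := (hD0 _ hmem).2 fun h => by
      have := hL i v (x * h)
      rw [map_mul] at this
      simp [this, hL, mul_pow, mul_assoc]
    rw [map_sub, map_smul, sub_eq_zero] at this
    exact congrFun this s
  refine ⟨Fin N → k, inferInstance, inferInstance, inferInstance, σ, ψ,
    LinearMap.intertwiningMap_of_isIntertwiningMap _ _ (e.toLinearMap ∘ₗ F.codRestrict _ hFR) ?_,
    hσ, ?_, ?_⟩
  · intro x v
    change e _ = ((ψ⁻¹ x.unop : kˣ) : k) • σ (MulOpposite.op (incl H x.unop)) (e _)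
    rw [he, ← map_smul]
    congr 1
    ext s
    change _ = ((ψ⁻¹ x.unop : kˣ) : k) * F v (incl H x.unop • s)
    rw [hFx, ← mul_assoc, MonoidHom.inv_apply, Units.inv_mul, one_mul]
    rfl
  · refine IsExtendible.of_apply_one_ne_zero (f := f * (δ : M → k) ^ n)
      (mul_mem hf (pow_mem hδ n)) (by simpa using hf1) fun x m => ?_
    simp only [Pi.mul_apply, Pi.pow_apply, hfχ, map_mul, hψ]
    ring
  · refine (injective_iff_map_eq_zero (e.toLinearMap ∘ₗ F.codRestrict _ hFR)).2 fun v hv => ?_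
    have hFv : F v = 0 := congrArg Subtype.val ((map_eq_zero_iff e e.injective).1 hv)
    refine b.ext_elem fun i => ?_
    have hDi : D (L i v) = 0 := funext fun s => congrFun hFv ⟨i, s⟩
    -- At the neutral element `L i v` is the `i`-th coordinate of `v`, since `δ 1 = 1`.
    have := (hD0 _ (hLT i v)).1 hDi 1
    rw [hL] at this
    simpa using this
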